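/- Let $M$ be a free abelian group of finite rank, $V=M\otimes\mathbb R$, and let $\mathcal R\subset M$ be a unimodular set, i.e. for every subset $B\subset\mathcal R$ the subgroup $\mathbb Z B\subset M$ generated by $B$ is pure (it consists of all points of $M$ lying in some rational linear subspace of $V$). The nonzero elements of $\mathcal R$ are called roots, and the $\mathcal R$-flats are the subspaces $\mathbb R B$ spanned by subsets $B\subset\mathcal R$. A polytope is the convex hull in $V$ of a nonempty finite set; a polytope $P$ is $\mathcal R$-convex if for every nonempty face $F$ of $P$ the tangent space $\mathbb R(F-F)$ is an $\mathcal R$-flat. An $\mathcal R$-zonotope is a translate of a Minkowski sum of finitely many (possibly degenerate) segments, each parallel to some root. Then a polytope $P\subset V$ is $\mathcal R$-convex if and only if there exists a polytope $P'\subset V$ such that the Minkowski sum $P+P'$ is an $\mathcal R$-zonotope. Moreover, if $P$ is $\mathcal R$-convex, then $\mathcal R$ is finite (as every unimodular set) and $P'$ can be chosen so that $P+P'=k\sum_{r\in\mathcal R}\mathrm{co}(\{-r,r\})$ for some real $k>0$. -/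

import Mathlib

open scoped TensorProduct Pointwise

namespace DiscreteConvexity

variable {M : Type*} [AddCommGroup M]

/-- The real vector space `V = ℝ ⊗ M` in which the free abelian group `M` is a lattice. -/
abbrev Ambient (M : Type*) [AddCommGroup M] : Type _ := ℝ ⊗[ℤ] M

/-- The canonical map `M → V`; its values are the integer points of `V`. -/
def intPoint (m : M) : Ambient M := (1 : ℝ) ⊗ₜ[ℤ] m

/-- A subspace of `V` is rational if it is spanned by integer points. -/
def IsRationalSubspace (F : Submodule ℝ (Ambient M)) : Prop :=
  ∃ A : Set M, F = Submodule.span ℝ (intPoint '' A)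

/-- A subgroup of `M` is pure if it consists of all integer points of some rational subspace. -/
def IsPureSubgroup (S : AddSubgroup M) : Prop :=
  ∃ F : Submodule ℝ (Ambient M), IsRationalSubspace F ∧ ∀ m : M, m ∈ S ↔ intPoint m ∈ F

/-- `R ⊆ M` is unimodular if every subset of `R` generates a pure subgroup of `M`. -/
def IsUnimodular (R : Set M) : Prop :=
  ∀ B : Set M, B ⊆ R → IsPureSubgroup (AddSubgroup.closure B)

/-- The roots of `R` are its nonzero elements. -/
def IsRoot (R : Set M) (r : M) : Prop := r ∈ R ∧ r ≠ 0

/-- An `R`-flat is a subspace of `V` spanned by a subset of `R`. -/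
def IsFlat (R : Set M) (F : Submodule ℝ (Ambient M)) : Prop :=
  ∃ B : Set M, B ⊆ R ∧ F = Submodule.span ℝ (intPoint '' B)

/-- A polytope is the convex hull of a nonempty finite set. -/
def IsPolytope (P : Set (Ambient M)) : Prop :=
  ∃ s : Finset (Ambient M), s.Nonempty ∧ P = convexHull ℝ (s : Set (Ambient M))

/-- A (nonempty) face of `P` is the nonempty set of maximizers on `P` of some linear functional.
The zero functional gives `P` itself. -/
def IsFace (P F : Set (Ambient M)) : Prop :=
  F.Nonempty ∧ ∃ p : Module.Dual ℝ (Ambient M), F = {x ∈ P | ∀ y ∈ P, p y ≤ p x}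

/-- The tangent space `ℝ (F - F)` of a set `F`. -/
def tangentSpace (F : Set (Ambient M)) : Submodule ℝ (Ambient M) :=
  Submodule.span ℝ (F - F)

/-- `P` is `R`-convex if the tangent space of every face of `P` is an `R`-flat. -/
def IsRConvex (R : Set M) (P : Set (Ambient M)) : Prop :=
  ∀ F : Set (Ambient M), IsFace P F → IsFlat R (tangentSpace F)

/-- An `R`-zonotope is a translate of a Minkowski sum of finitely many (possibly degenerate)
segments, each of them parallel to a root of `R`. -/
def IsRZonotope (R : Set M) (Z : Set (Ambient M)) : Prop :=
  ∃ (n : ℕ) (x : Ambient M) (r : Fin n → M) (c : Fin n → ℝ), (∀ i, IsRoot R (r i)) ∧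
    Z = {x} + ∑ i, segment ℝ (0 : Ambient M) (c i • intPoint (r i))

/-- The symmetric zonotope `∑ [-r, r]`, with `r` running over a finite set `S ⊆ M`. -/
def symmZonotope (S : Finset M) : Set (Ambient M) :=
  ∑ r ∈ S, segment ℝ (-intPoint r) (intPoint r)

end DiscreteConvexity

namespace DiscreteConvexity

open Filter Topology

/-! ### Local supports, separation and support functions -/

section Geometry

/-! Unimodularity serves only to make `R` finite: two elements congruent modulo 3 coincide
(`IsUnimodular.eq_of_sub_eq`).

If `P` is `R`-convex, a complement of `P` in `k` times the symmetric zonotope must have support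
function `k * ∑ |p r| - h_P p`, which is `supportDiff`. For large `k` it is convex: near `p` only
the face of `P` in direction `p` matters, and its differences are combinations, with coefficients at
most `k`, of roots orthogonal to `p`, exactly where `k * |p r|` bends. This gives a local linear
support at every `p` (`eventually_le_supportDiff`), and along lines local supports are global
(`add_le_of_local_support`). The finitely many supporting points span `P'`; separation gives
equality.

Conversely, perturb `p` without changing the values on a face of `P` relative to each other, so that
the face of the zonotope in the new direction involves only segments in the tangent space of that
face. Its differences are then combinations of roots in that space (`sub_mem_of_add_eq_zonotope`).
-/

/-- A continuous function of one variable that has an affine local support at every point is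
globally supported by each of its local supports. -/
theorem add_le_of_local_support {g : ℝ → ℝ} (hg : Continuous g)
    (hloc : ∀ t₀, ∃ a, ∀ᶠ t in 𝓝 t₀, g t₀ + a * (t - t₀) ≤ g t) {b : ℝ}
    (hb : ∀ᶠ t in 𝓝 0, g 0 + b * t ≤ g t) : g 0 + b ≤ g 1 := by
  by_contra! hlt
  obtain ⟨c, hc⟩ : ∃ c, c = g 0 + b - g 1 := ⟨_, rfl⟩
  have hc0 : 0 < c := by linarith
  -- The tilt `c` makes `H` vanish at 0 and 1, yet `H` is positive just after 0. At its leftmost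
  -- maximum a local support would need positive slope from the left and nonpositive slope from the
  -- right.
  obtain ⟨H, hH⟩ : ∃ H : ℝ → ℝ, H = fun t => g t - g 0 - b * t + c * t := ⟨_, rfl⟩
  have hHc : Continuous H := by rw [hH]; fun_prop
  have H0 : H 0 = 0 := by simp [hH]
  have H1 : H 1 = 0 := by simp only [hH, hc]; ring
  obtain ⟨m, hmI, hm⟩ := isCompact_Icc.exists_isMaxOn (s := Set.Icc (0 : ℝ) 1) (f := H)
    ⟨0, by simp⟩ hHc.continuousOn
  have hmpos : 0 < H m := by
    have h1 : ∀ᶠ t in 𝓝[>] (0 : ℝ), g 0 + b * t ≤ g t := hb.filter_mono nhdsWithin_le_nhds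
    have h2 : ∀ᶠ t in 𝓝[>] (0 : ℝ), t ∈ Set.Ioo (0 : ℝ) 1 := Ioo_mem_nhdsGT one_pos
    obtain ⟨t, ht, ht2⟩ := (h1.and h2).exists
    have h3 : H t ≤ H m := hm ⟨ht2.1.le, ht2.2.le⟩
    have h4 : 0 < c * t := mul_pos hc0 ht2.1
    have h5 : H t = g t - g 0 - b * t + c * t := by rw [hH]
    linarith
  obtain ⟨t₀, ⟨⟨ht₀I, ht₀m⟩, ht₀⟩⟩ := (isCompact_Icc.inter_right
    (isClosed_eq hHc continuous_const : IsClosed {t | H t = H m})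
      : IsCompact (Set.Icc (0 : ℝ) 1 ∩ {t | H t = H m})).exists_isLeast ⟨m, hmI, rfl⟩
  replace ht₀m : H t₀ = H m := ht₀m
  have hpos : 0 < t₀ := lt_of_le_of_ne ht₀I.1 (by rintro rfl; linarith)
  have hlt1 : t₀ < 1 := lt_of_le_of_ne ht₀I.2 (by rintro rfl; linarith)
  obtain ⟨a, ha⟩ := hloc t₀
  have ha' : ∀ᶠ t in 𝓝 t₀, H t₀ + (a - b + c) * (t - t₀) ≤ H t ∧ t ∈ Set.Ioo (0 : ℝ) 1 := by
    filter_upwards [ha, Ioo_mem_nhds hpos hlt1] with t ht ht'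
    refine ⟨?_, ht'⟩
    rw [hH]; dsimp only; linarith
  obtain ⟨t, ⟨ht1, ht2⟩, ht3⟩ := ((ha'.filter_mono nhdsWithin_le_nhds).and
    (self_mem_nhdsWithin : Set.Iio t₀ ∈ 𝓝[<] t₀)).exists
  obtain ⟨u, ⟨hu1, hu2⟩, hu3⟩ := ((ha'.filter_mono nhdsWithin_le_nhds).and
    (self_mem_nhdsWithin : Set.Ioi t₀ ∈ 𝓝[>] t₀)).exists
  have htm : H t ≤ H m := hm ⟨ht2.1.le, ht2.2.le⟩
  have hum : H u ≤ H m := hm ⟨hu2.1.le, hu2.2.le⟩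
  have htne : H t ≠ H m := fun h => absurd (ht₀ ⟨⟨ht2.1.le, ht2.2.le⟩, h⟩) (not_le.2 ht3)
  have htlt : H t < H m := lt_of_le_of_ne htm htne
  replace ht3 : t < t₀ := ht3
  replace hu3 : t₀ < u := hu3
  have : 0 < a - b + c := by
    by_contra! h
    nlinarith
  nlinarith

variable {E : Type*} [AddCommGroup E] [Module ℝ E]

theorem exists_dual_lt_of_notMem_convexHull [FiniteDimensional ℝ E] {s : Set E} (hs : s.Finite)
    {x : E} (hx : x ∉ convexHull ℝ s) : ∃ p : Module.Dual ℝ E, ∀ y ∈ s, p y < p x := by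
  -- `E` carries no topology, so Hahn–Banach is applied in coordinates.
  let e : E ≃ₗ[ℝ] (Fin (Module.finrank ℝ E) → ℝ) :=
    LinearEquiv.ofFinrankEq _ _ (by simp)
  have hx' : e x ∉ convexHull ℝ (e '' s) := by
    intro h
    have h2 := e.toLinearMap.isLinear.image_convexHull (s := s)
    change e '' _ = convexHull ℝ (e '' s) at h2
    rw [← h2] at h
    obtain ⟨y, hy, hyx⟩ := h
    exact hx (e.injective hyx ▸ hy)
  obtain ⟨f, u, hf, hu⟩ := geometric_hahn_banach_closed_point (convex_convexHull ℝ (e '' s))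
    ((hs.image e).isClosed_convexHull ℝ) hx'
  refine ⟨f.toLinearMap ∘ₗ e.toLinearMap, fun y hy => ?_⟩
  exact (hf _ (subset_convexHull ℝ _ ⟨y, hy, rfl⟩)).trans hu

theorem dual_le_of_mem_convexHull {s : Set E} (p : Module.Dual ℝ E) {a : ℝ}
    (h : ∀ y ∈ s, p y ≤ a) {x : E} (hx : x ∈ convexHull ℝ s) : p x ≤ a := by
  have hc : Convex ℝ {x | p x ≤ a} := convex_halfSpace_le p.isLinear a
  exact convexHull_min h hc hx

/-- The support function of a finite sum of symmetric segments. -/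
theorem dual_le_of_mem_sum_segment {ι : Type*} (S : Finset ι) (r : ι → E) (p : Module.Dual ℝ E)
    {x : E} (hx : x ∈ ∑ i ∈ S, segment ℝ (-r i) (r i)) : p x ≤ ∑ i ∈ S, |p (r i)| := by
  rw [Set.mem_finsetSum] at hx
  obtain ⟨y, hy, rfl⟩ := hx
  rw [map_sum]
  refine Finset.sum_le_sum fun i hi => ?_
  have := hy hi
  rw [← convexHull_pair] at this
  refine dual_le_of_mem_convexHull p ?_ this
  rintro z (rfl | rfl)
  · rw [map_neg]; exact neg_le_abs _
  · exact le_abs_self _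

theorem exists_finset_sum_segment_eq_convexHull {ι : Type*} (S : Finset ι) (r : ι → E) :
    ∃ T : Set E, T.Finite ∧ ∑ i ∈ S, segment ℝ (-r i) (r i) = convexHull ℝ T := by
  classical
  refine ⟨∑ i ∈ S, {-r i, r i}, ?_, ?_⟩
  · refine Finset.induction_on S (by simp [Set.finite_zero]) fun i S hi ih => ?_
    rw [Finset.sum_insert hi]
    exact (Set.toFinite _).add ih
  · rw [convexHull_sum]
    simp_rw [convexHull_pair]

theorem sum_sign_mem_sum_segment {ι : Type*} (S : Finset ι) (r : ι → E) (p : Module.Dual ℝ E) :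
    ∑ i ∈ S, (SignType.sign (p (r i)) : ℝ) • r i ∈ ∑ i ∈ S, segment ℝ (-r i) (r i) := by
  refine Set.finsetSum_mem_finsetSum _ _ _ fun i _ => ?_
  rcases SignType.trichotomy (SignType.sign (p (r i))) with h | h | h <;> rw [h]
  · simpa using left_mem_segment ℝ (-r i) (r i)
  · refine ⟨1/2, 1/2, by norm_num, by norm_num, by norm_num, by simp⟩
  · simpa using right_mem_segment ℝ (-r i) (r i)

/-- Coefficients of differences of points of a finite set with respect to the spans that contain
them may be bounded uniformly. -/
theorem exists_bounded_coeff {ι : Type*} (S : Finset ι) (r : ι → E) (s : Finset E) :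
    ∃ k : ℝ, 0 < k ∧ ∀ B ⊆ S, ∀ x ∈ s, ∀ y ∈ s,
      x - y ∈ Submodule.span ℝ (r '' (B : Set ι)) →
        ∃ c : ι → ℝ, (∀ i ∈ B, |c i| ≤ k) ∧ ∑ i ∈ B, c i • r i = x - y := by
  have key : ∀ᶠ k : ℝ in atTop, ∀ B ∈ S.powerset, ∀ x ∈ s, ∀ y ∈ s,
      x - y ∈ Submodule.span ℝ (r '' (B : Set ι)) →
        ∃ c : ι → ℝ, (∀ i ∈ B, |c i| ≤ k) ∧ ∑ i ∈ B, c i • r i = x - y := by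
    simp only [eventually_all_finset, eventually_imp_distrib_left]
    intro B _ x _ y _ h
    rw [Submodule.mem_span_image_finset_iff_exists_fun'] at h
    obtain ⟨c, hc⟩ := h
    have : ∀ᶠ k : ℝ in atTop, ∀ i ∈ B, |c i| ≤ k :=
      (eventually_all_finset B).2 fun i _ => eventually_ge_atTop _
    filter_upwards [this] with k hk
    exact ⟨c, hk, hc⟩
  obtain ⟨k, hk, hk0⟩ := (key.and (eventually_gt_atTop 0)).exists
  exact ⟨k, hk0, fun B hB => hk B (Finset.mem_powerset.2 hB)⟩

end Geometry

/-! ### Convexity of the support difference -/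

section Summand
variable {E : Type*} [AddCommGroup E] [Module ℝ E] {ι : Type*}

/-- The support function of the difference of a zonotope, dilated by `k`, and a polytope. -/
noncomputable def supportDiff (S : Finset ι) (r : ι → E) {s : Finset E} (hs : s.Nonempty) (k : ℝ)
    (p : Module.Dual ℝ E) : ℝ :=
  k * ∑ i ∈ S, |p (r i)| - s.sup' hs (fun x => p x)

/-- The difference of a point of the face of the dilated zonotope in direction `p` and `v`. -/
noncomputable def supportPoint (S : Finset ι) (r : ι → E) (k : ℝ) (p : Module.Dual ℝ E) (v : E) :
    E :=
  k • ∑ i ∈ S, (SignType.sign (p (r i)) : ℝ) • r i - v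

theorem sign_mul_le_abs (σ : SignType) (x : ℝ) : (σ : ℝ) * x ≤ |x| := by
  rcases SignType.trichotomy σ with rfl | rfl | rfl
  · simpa using neg_le_abs x
  · simp
  · simpa using le_abs_self x

theorem dual_supportPoint (S : Finset ι) (r : ι → E) (k : ℝ) (p q : Module.Dual ℝ E) (v : E) :
    q (supportPoint S r k p v) =
      k * ∑ i ∈ S, (SignType.sign (p (r i)) : ℝ) * q (r i) - q v := by
  simp [supportPoint, map_sum]

theorem dual_supportPoint_self (S : Finset ι) (r : ι → E) (k : ℝ) (p : Module.Dual ℝ E) (v : E) :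
    p (supportPoint S r k p v) = k * ∑ i ∈ S, |p (r i)| - p v := by
  rw [dual_supportPoint]
  simp_rw [sign_mul_self]

variable {S : Finset ι} {r : ι → E} {s : Finset E} (hs : s.Nonempty) {k : ℝ}

theorem supportDiff_eq {p : Module.Dual ℝ E} {v : E} (hv : v ∈ s) (hmax : ∀ y ∈ s, p y ≤ p v) :
    supportDiff S r hs k p = p (supportPoint S r k p v) := by
  have : s.sup' hs (fun x => p x) = p v :=
    le_antisymm (Finset.sup'_le _ _ hmax) (Finset.le_sup' (fun x => p x) hv)
  rw [dual_supportPoint_self, supportDiff, this]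

theorem continuous_supportDiff (p u : Module.Dual ℝ E) :
    Continuous fun t : ℝ => supportDiff S r hs k (p + t • u) := by
  simp only [supportDiff, LinearMap.add_apply, LinearMap.smul_apply]
  refine Continuous.sub (by fun_prop) ?_
  exact Continuous.finset_sup'_apply hs fun i _ => by fun_prop

/-- For small `t` a point of `s` off the face in direction `p` stays below `v`. A point `y` on the
face has `y - v` in the span of `r i` orthogonal to `p`, and the coefficient bound lets `k * |q (r
i)|` absorb `q (y - v)`. -/
theorem eventually_le_supportDiff (hk : 0 ≤ k)
    (hcoeff : ∀ B ⊆ S, ∀ x ∈ s, ∀ y ∈ s, x - y ∈ Submodule.span ℝ (r '' (B : Set ι)) →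
        ∃ c : ι → ℝ, (∀ i ∈ B, |c i| ≤ k) ∧ ∑ i ∈ B, c i • r i = x - y)
    {p : Module.Dual ℝ E}
    (hflat : ∃ B ⊆ S, (∀ i ∈ B, p (r i) = 0) ∧ ∀ x ∈ s, ∀ y ∈ s,
      (∀ z ∈ s, p z ≤ p x) → (∀ z ∈ s, p z ≤ p y) →
        x - y ∈ Submodule.span ℝ (r '' (B : Set ι)))
    (u : Module.Dual ℝ E) {v : E} (hv : v ∈ s) (hmax : ∀ y ∈ s, p y ≤ p v) :
    ∀ᶠ t : ℝ in 𝓝 0,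
      (p + t • u) (supportPoint S r k p v) ≤ supportDiff S r hs k (p + t • u) := by
  have hev : ∀ᶠ t : ℝ in 𝓝 0, ∀ y ∈ s, p y < p v → (p + t • u) y < (p + t • u) v := by
    simp only [eventually_all_finset, eventually_imp_distrib_left]
    intro y _ hy
    have h1 : Continuous fun t : ℝ => (p + t • u) y := by
      simp only [LinearMap.add_apply, LinearMap.smul_apply]; fun_prop
    have h2 : Continuous fun t : ℝ => (p + t • u) v := by
      simp only [LinearMap.add_apply, LinearMap.smul_apply]; fun_prop
    exact h1.continuousAt.eventually_lt h2.continuousAt (by simpa using hy)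
  filter_upwards [hev] with t ht
  obtain ⟨q, hq⟩ : ∃ q, q = p + t • u := ⟨_, rfl⟩
  rw [← hq] at ht ⊢
  rw [dual_supportPoint, supportDiff]
  have hnn : ∀ i ∈ S, 0 ≤ |q (r i)| - (SignType.sign (p (r i)) : ℝ) * q (r i) := fun i _ =>
    sub_nonneg.2 (sign_mul_le_abs _ _)
  suffices h : ∀ y ∈ s, q y ≤
      k * ∑ i ∈ S, (|q (r i)| - (SignType.sign (p (r i)) : ℝ) * q (r i)) + q v by
    have := Finset.sup'_le hs (fun x => q x) h
    rw [Finset.sum_sub_distrib] at this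
    linarith
  intro y hy
  rcases (hmax y hy).lt_or_eq with hlt | heq
  · have := ht y hy hlt
    have := mul_nonneg hk (Finset.sum_nonneg hnn)
    linarith
  · obtain ⟨B, hBS, hB0, hB⟩ := hflat
    obtain ⟨c, hck, hc⟩ := hcoeff B hBS y hy v hv
      (hB y hy v hv (fun z hz => heq ▸ hmax z hz) hmax)
    have h1 : q y - q v = ∑ i ∈ B, c i * q (r i) := by
      rw [← map_sub, ← hc, map_sum]; simp
    have h2 : ∑ i ∈ B, c i * q (r i) ≤
        ∑ i ∈ B, k * (|q (r i)| - (SignType.sign (p (r i)) : ℝ) * q (r i)) := by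
      refine Finset.sum_le_sum fun i hi => ?_
      -- As `sign 0 = 0`, `supportPoint` takes the midpoint of these segments, leaving all of `k *
      -- |q (r i)|` available.
      rw [hB0 i hi, sign_zero, SignType.coe_zero, zero_mul, sub_zero]
      calc c i * q (r i) ≤ |c i * q (r i)| := le_abs_self _
        _ = |c i| * |q (r i)| := abs_mul _ _
        _ ≤ k * |q (r i)| := mul_le_mul_of_nonneg_right (hck i hi) (abs_nonneg _)
    rw [← Finset.mul_sum] at h2
    have h3 := mul_le_mul_of_nonneg_left (Finset.sum_le_sum_of_subset_of_nonneg hBS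
      (f := fun i => |q (r i)| - (SignType.sign (p (r i)) : ℝ) * q (r i))
      fun i hi _ => hnn i hi) hk
    linarith

/-- A local support of the positively homogeneous function `supportDiff` is a global one. -/
theorem dual_supportPoint_le (hk : 0 ≤ k)
    (hcoeff : ∀ B ⊆ S, ∀ x ∈ s, ∀ y ∈ s, x - y ∈ Submodule.span ℝ (r '' (B : Set ι)) →
        ∃ c : ι → ℝ, (∀ i ∈ B, |c i| ≤ k) ∧ ∑ i ∈ B, c i • r i = x - y)
    (hflat : ∀ p : Module.Dual ℝ E, ∃ B ⊆ S, (∀ i ∈ B, p (r i) = 0) ∧ ∀ x ∈ s, ∀ y ∈ s,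
      (∀ z ∈ s, p z ≤ p x) → (∀ z ∈ s, p z ≤ p y) →
        x - y ∈ Submodule.span ℝ (r '' (B : Set ι)))
    (p q : Module.Dual ℝ E) {v : E} (hv : v ∈ s) (hmax : ∀ y ∈ s, p y ≤ p v) :
    q (supportPoint S r k p v) ≤ supportDiff S r hs k q := by
  obtain ⟨u, rfl⟩ : ∃ u, q = p + u := ⟨q - p, by abel⟩
  have key := add_le_of_local_support (continuous_supportDiff (S := S) (r := r) hs (k := k) p u)
    (fun t₀ => ?_) (b := u (supportPoint S r k p v)) ?_
  · rwa [zero_smul, add_zero, one_smul, supportDiff_eq hs hv hmax, ← LinearMap.add_apply] at key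
  · obtain ⟨v₀, hv₀, hmax₀⟩ := s.exists_max_image (fun x => (p + t₀ • u) x) hs
    refine ⟨u (supportPoint S r k (p + t₀ • u) v₀), ?_⟩
    have h := eventually_le_supportDiff hs hk hcoeff (hflat _) u hv₀ hmax₀
    have ht : Tendsto (fun t : ℝ => t - t₀) (𝓝 t₀) (𝓝 0) := by
      exact tendsto_sub_nhds_zero_iff.2 tendsto_id
    filter_upwards [ht.eventually h] with t h
    rw [supportDiff_eq hs hv₀ hmax₀]
    have he : p + t₀ • u + (t - t₀) • u = p + t • u := by module
    rw [he] at h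
    refine le_trans (le_of_eq ?_) h
    rw [← he, LinearMap.add_apply (p + t₀ • u), LinearMap.smul_apply, smul_eq_mul, mul_comm]
  · filter_upwards [eventually_le_supportDiff hs hk hcoeff (hflat p) u hv hmax] with t h
    rw [zero_smul, add_zero, supportDiff_eq hs hv hmax]
    simpa [mul_comm] using h

/-- The functional enters only through the signs of its values on the `r i`. -/
theorem finite_supportPoints (S : Finset ι) (r : ι → E) (s : Finset E) (k : ℝ) :
    {w | ∃ p : Module.Dual ℝ E, ∃ v ∈ s, (∀ y ∈ s, p y ≤ p v) ∧
      w = supportPoint S r k p v}.Finite := by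
  refine (Set.finite_range fun a : (S → SignType) × s =>
    k • ∑ i : S, ((a.1 i : SignType) : ℝ) • r i - (a.2 : E)).subset ?_
  rintro w ⟨p, v, hv, -, rfl⟩
  refine ⟨(fun i => SignType.sign (p (r i)), ⟨v, hv⟩), ?_⟩
  simp only [supportPoint]
  rw [← Finset.sum_coe_sort S]

/-- A polytope all of whose faces have tangent spaces spanned by vectors `r i` is a summand of a
dilated zonotope. -/
theorem exists_add_eq_smul_sum_segment [FiniteDimensional ℝ E] (S : Finset ι) (r : ι → E)
    {s : Finset E} (hs : s.Nonempty)
    (hflat : ∀ p : Module.Dual ℝ E, ∃ B ⊆ S, (∀ i ∈ B, p (r i) = 0) ∧ ∀ x ∈ s, ∀ y ∈ s,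
      (∀ z ∈ s, p z ≤ p x) → (∀ z ∈ s, p z ≤ p y) →
        x - y ∈ Submodule.span ℝ (r '' (B : Set ι))) :
    ∃ W : Finset E, W.Nonempty ∧ ∃ k : ℝ, 0 < k ∧
      convexHull ℝ (s : Set E) + convexHull ℝ (W : Set E) =
        k • ∑ i ∈ S, segment ℝ (-r i) (r i) := by
  obtain ⟨k, hk, hcoeff⟩ := exists_bounded_coeff S r s
  have hW := finite_supportPoints S r s k
  have hmem : ∀ w, w ∈ hW.toFinset ↔ ∃ p : Module.Dual ℝ E, ∃ v ∈ s, (∀ y ∈ s, p y ≤ p v) ∧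
      w = supportPoint S r k p v := fun w => hW.mem_toFinset
  refine ⟨hW.toFinset, ?_, k, hk, ?_⟩
  · obtain ⟨v, hv, hmax⟩ := s.exists_max_image (fun x => (0 : Module.Dual ℝ E) x) hs
    exact ⟨_, (hmem _).2 ⟨0, v, hv, hmax, rfl⟩⟩
  have hle : ∀ (p : Module.Dual ℝ E), ∀ x ∈ k • ∑ i ∈ S, segment ℝ (-r i) (r i),
      p x ≤ k * ∑ i ∈ S, |p (r i)| := by
    rintro p _ ⟨x, hx, rfl⟩
    simpa using mul_le_mul_of_nonneg_left (dual_le_of_mem_sum_segment S r p hx) hk.le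
  rw [← convexHull_add]
  apply Set.Subset.antisymm
  · obtain ⟨T, hT, hTeq⟩ := exists_finset_sum_segment_eq_convexHull S r
    rw [hTeq, ← convexHull_smul]
    refine convexHull_min ?_ (convex_convexHull _ _)
    rintro _ ⟨x, hx, w, hw, rfl⟩
    by_contra hnot
    obtain ⟨q, hq⟩ := exists_dual_lt_of_notMem_convexHull (hT.smul_set (a := k)) hnot
    obtain ⟨p, v, hv, hmax, rfl⟩ := (hmem w).1 hw
    have h1 := dual_supportPoint_le hs hk.le hcoeff hflat p q hv hmax
    have h2 := Finset.le_sup' (fun x => q x) hx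
    have h3 : k • ∑ i ∈ S, (SignType.sign (q (r i)) : ℝ) • r i ∈ convexHull ℝ (k • T) := by
      rw [convexHull_smul, ← hTeq]
      exact Set.smul_mem_smul_set (sum_sign_mem_sum_segment S r q)
    have h4 : k * ∑ i ∈ S, |q (r i)| < q (x + supportPoint S r k p v) := by
      have h6 : ∃ y ∈ k • T, q (k • ∑ i ∈ S, (SignType.sign (q (r i)) : ℝ) • r i) ≤ q y := by
        by_contra! h7
        rcases (k • T).eq_empty_or_nonempty with he | hne
        · rw [he] at h3; simp at h3
        obtain ⟨y, hy, hym⟩ := Set.exists_max_image (k • T) q hT.smul_set hne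
        have := dual_le_of_mem_convexHull q hym h3
        exact absurd (h7 y hy) (not_lt.2 this)
      obtain ⟨y, hy, hyq⟩ := h6
      refine lt_of_le_of_lt (le_trans (le_of_eq ?_) hyq) (hq y hy)
      simp [map_sum, sign_mul_self]
    rw [supportDiff] at h1
    rw [map_add] at h4
    linarith
  -- The point `v` maximizing a separating `q` and its own supporting point add up to a point where
  -- `q` equals `k * ∑ |q (r i)|`, its bound on the dilated zonotope.
  · intro x hx
    by_contra hnot
    obtain ⟨q, hq⟩ := exists_dual_lt_of_notMem_convexHull
      (s.finite_toSet.add hW.toFinset.finite_toSet) hnot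
    obtain ⟨v, hv, hmax⟩ := s.exists_max_image (fun x => q x) hs
    have h1 := hq _ (Set.add_mem_add hv ((hmem _).2 ⟨q, v, hv, hmax, rfl⟩))
    have h2 := hle q x hx
    rw [map_add, dual_supportPoint_self] at h1
    linarith

end Summand

/-! ### Finiteness of unimodular sets; passage to roots -/

section Unimodular
variable {M : Type*} [AddCommGroup M]

theorem intPoint_zsmul (n : ℤ) (m : M) : intPoint (n • m) = (n : ℝ) • intPoint m := by
  simp [intPoint, TensorProduct.smul_tmul']

theorem IsPureSubgroup.mem_of_zsmul_mem {S : AddSubgroup M} (h : IsPureSubgroup S) {n : ℤ}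
    (hn : n ≠ 0) {m : M} (hm : n • m ∈ S) : m ∈ S := by
  obtain ⟨F, -, hF⟩ := h
  rw [hF, intPoint_zsmul] at hm
  rw [hF]
  exact (F.smul_mem_iff (Int.cast_ne_zero.2 hn)).1 hm

theorem IsUnimodular.mem_zmultiples {R : Set M} (hR : IsUnimodular R) {r : M} (hr : r ∈ R) {n : ℤ}
    (hn : n ≠ 0) {m : M} (hm : n • m ∈ AddSubgroup.zmultiples r) :
    m ∈ AddSubgroup.zmultiples r := by
  have h := hR {r} (by simpa using hr)
  rw [← AddSubgroup.zmultiples_eq_closure] at h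
  exact h.mem_of_zsmul_mem hn hm

/-- Elements of a unimodular set that are congruent modulo `3` are equal. -/
theorem IsUnimodular.eq_of_sub_eq [Module.IsTorsionFree ℤ M] {R : Set M} (hR : IsUnimodular R) {r r' : M}
    (hr : r ∈ R) (hr' : r' ∈ R) {m : M} (h : r - r' = (3 : ℤ) • m) : r = r' := by
  have hpure := hR {r, r'} (by simp [Set.insert_subset_iff, hr, hr'])
  have hm : m ∈ AddSubgroup.closure {r, r'} := by
    refine hpure.mem_of_zsmul_mem (n := 3) (by norm_num) ?_
    rw [← h]
    exact sub_mem (AddSubgroup.subset_closure (by simp)) (AddSubgroup.subset_closure (by simp))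
  obtain ⟨a, b, hab⟩ := AddSubgroup.mem_closure_pair.1 hm
  -- Both coefficients are nonzero modulo 3, so purity makes `r` and `r'` multiples of each other.
  have hrel : (1 - 3 * a) • r = (1 + 3 * b) • r' := by
    have : r - r' = (3 : ℤ) • (a • r + b • r') := by rw [hab, h]
    have h2 : (1 - 3 * a) • r - (1 + 3 * b) • r' = (r - r') - (3 : ℤ) • (a • r + b • r') := by
      module
    rw [← sub_eq_zero, h2, this, sub_self]
  have h1 : r ∈ AddSubgroup.zmultiples r' :=
    hR.mem_zmultiples hr' (n := 1 - 3 * a) (by omega) (hrel ▸ ⟨_, rfl⟩)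
  have h2 : r' ∈ AddSubgroup.zmultiples r :=
    hR.mem_zmultiples hr (n := 1 + 3 * b) (by omega) (hrel ▸ ⟨_, rfl⟩)
  obtain ⟨c, hc⟩ := h1
  obtain ⟨d, hd⟩ := h2
  replace hc : c • r' = r := hc
  replace hd : d • r = r' := hd
  have hz : ∀ n : ℤ, n ≠ 0 → n • r = 0 → r = r' := by
    intro n hn h0
    have : r = 0 := (smul_eq_zero.1 h0).resolve_left hn
    rw [← hd, this, smul_zero]
  by_cases hcd : c * d = 1
  · rcases Int.mul_eq_one_iff_eq_one_or_neg_one.1 hcd with ⟨rfl, rfl⟩ | ⟨rfl, rfl⟩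
    · rw [← hc, one_smul]
    -- Here `r' = -r`, which modulus 2 could not exclude; modulo 3 it makes `r` divisible by 3, and
    -- purity forces `r = 0`.
    · have h3 : (3 : ℤ) • (r - m) = r := by
        rw [smul_sub, ← h, ← hd]; module
      obtain ⟨e, he⟩ := hR.mem_zmultiples hr (n := 3) (by norm_num) (m := r - m)
        (by rw [h3]; exact AddSubgroup.mem_zmultiples r)
      replace he : e • r = r - m := he
      refine hz (3 * e - 1) (by omega) ?_
      rw [sub_smul, mul_smul, he, h3, one_smul, sub_self]
  · refine hz (c * d - 1) (by omega) ?_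
    rw [sub_smul, mul_smul, hd, hc, one_smul, sub_self]

theorem IsUnimodular.finite [Module.Free ℤ M] [Module.Finite ℤ M] {R : Set M}
    (hR : IsUnimodular R) : R.Finite := by
  let b := Module.Free.chooseBasis ℤ M
  refine Set.Finite.of_injOn (f := fun (m : M) i => ((b.repr m i : ℤ) : ZMod 3))
    (t := Set.univ) (fun _ _ => Set.mem_univ _) ?_ Set.finite_univ
  intro r hr r' hr' h
  have hdvd : ∀ i, ∃ c, b.repr r i - b.repr r' i = 3 * c := fun i =>
    ((ZMod.intCast_eq_intCast_iff_dvd_sub _ _ 3).1 (congrFun h i).symm)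
  choose c hc using hdvd
  refine hR.eq_of_sub_eq hr hr' (m := ∑ i, c i • b i) ?_
  refine b.repr.injective (Finsupp.ext fun i => ?_)
  simp [hc, Finsupp.single_apply, b.repr_self]

/-- The exposed points of an `R`-convex polytope differ by elements of `R`-flats. -/
theorem IsRConvex.exists_finset {S : Finset M} {s : Finset (Ambient M)} (hs : s.Nonempty)
    (h : IsRConvex (S : Set M) (convexHull ℝ (s : Set (Ambient M))))
    (p : Module.Dual ℝ (Ambient M)) :
    ∃ B ⊆ S, (∀ i ∈ B, p (intPoint i) = 0) ∧ ∀ x ∈ s, ∀ y ∈ s,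
      (∀ z ∈ s, p z ≤ p x) → (∀ z ∈ s, p z ≤ p y) →
        x - y ∈ Submodule.span ℝ (intPoint '' (B : Set M)) := by
  obtain ⟨F, hF⟩ : ∃ F : Set (Ambient M), F = {x ∈ convexHull ℝ (s : Set (Ambient M)) |
      ∀ y ∈ convexHull ℝ (s : Set (Ambient M)), p y ≤ p x} := ⟨_, rfl⟩
  have hmem : ∀ x ∈ s, (∀ z ∈ s, p z ≤ p x) → x ∈ F := fun x hx hmax => by
    rw [hF]
    exact ⟨subset_convexHull ℝ _ hx, fun y hy => dual_le_of_mem_convexHull p hmax hy⟩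
  obtain ⟨v, hv, hmax⟩ := s.exists_max_image (fun x => p x) hs
  obtain ⟨B, hBS, hB⟩ := h F ⟨⟨v, hmem v hv hmax⟩, p, hF⟩
  -- `p` is constant on its face, so the roots spanning the flat are orthogonal to `p`.
  have hker : tangentSpace F ≤ LinearMap.ker p := by
    refine Submodule.span_le.2 ?_
    rintro _ ⟨x, hx, y, hy, rfl⟩
    rw [hF] at hx hy
    have := le_antisymm (hx.2 y hy.1) (hy.2 x hx.1)
    simp [this]
  have hBfin := S.finite_toSet.subset hBS
  refine ⟨hBfin.toFinset, fun i hi => hBS (hBfin.mem_toFinset.1 hi), fun i hi => ?_, ?_⟩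
  · refine hker ?_
    rw [hB]
    exact Submodule.subset_span ⟨i, hBfin.mem_toFinset.1 hi, rfl⟩
  · intro x hx y hy hxm hym
    rw [hBfin.coe_toFinset, ← hB]
    exact Submodule.subset_span ⟨x, hmem x hx hxm, y, hmem y hy hym, rfl⟩

theorem isRZonotope_smul_symmZonotope (S : Finset M) (k : ℝ) :
    IsRZonotope (S : Set M) (k • symmZonotope S) := by
  classical
  -- Zero may lie in `S` but is not a root; its segment is trivial.
  obtain ⟨T, hT⟩ : ∃ T, T = S.filter (· ≠ 0) := ⟨_, rfl⟩
  refine ⟨T.card, -∑ r ∈ T, k • intPoint r, fun i => (T.equivFin.symm i : M), fun _ => 2 * k,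
    fun i => ?_, ?_⟩
  · have hmem : ∀ m ∈ T, m ∈ S ∧ m ≠ 0 := fun m hm => Finset.mem_filter.1 (hT ▸ hm)
    exact hmem _ (T.equivFin.symm i).2
  · have h0 : symmZonotope S = ∑ r ∈ T, segment ℝ (-intPoint r) (intPoint r) := by
      rw [symmZonotope, hT]
      refine (Finset.sum_subset (Finset.filter_subset _ _) fun r hr hr' => ?_).symm
      have : r = 0 := by simpa [hr] using hr'
      simp [this, intPoint, Set.singleton_zero]
    have h1 : ∑ i : Fin T.card, segment ℝ (0 : Ambient M)
        ((2 * k) • intPoint (T.equivFin.symm i : M)) =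
        ∑ r ∈ T, segment ℝ (0 : Ambient M) ((2 * k) • intPoint r) := by
      rw [← Finset.sum_coe_sort T]
      exact Equiv.sum_comp T.equivFin.symm
        fun r : T => segment ℝ (0 : Ambient M) ((2 * k) • intPoint (r : M))
    have h2 : ({-∑ r ∈ T, k • intPoint r} : Set (Ambient M)) =
        ∑ r ∈ T, {-(k • intPoint r)} := by
      rw [Set.finsetSum_singleton, Finset.sum_neg_distrib]
    rw [h1, h2, ← Finset.sum_add_distrib, h0, Finset.smul_sum]
    refine Finset.sum_congr rfl fun r _ => ?_
    rw [Set.singleton_add, segment_translate_image]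
    have h3 := image_segment ℝ (k • LinearMap.id : Ambient M →ₗ[ℝ] Ambient M).toAffineMap
      (-intPoint r) (intPoint r)
    refine h3.trans ?_
    congr 1
    · simp
    · simp only [LinearMap.coe_toAffineMap, LinearMap.smul_apply, LinearMap.id_apply]
      module

end Unimodular

/-! ### Faces of a summand of a zonotope -/

section Summand
variable {E : Type*} [AddCommGroup E] [Module ℝ E]

/-- Points of the same face of a zonotope differ by a combination of the segments that are
orthogonal to the functional that defines the face. -/
theorem sub_mem_of_mem_face {n : ℕ} {x : E} {v : Fin n → E} {p : Module.Dual ℝ E}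
    {U : Submodule ℝ E} (hU : ∀ i, p (v i) = 0 → v i ∈ U) {y z : E}
    (hy : y ∈ {x} + ∑ i, segment ℝ 0 (v i)) (hz : z ∈ {x} + ∑ i, segment ℝ 0 (v i))
    (hymax : ∀ w ∈ {x} + ∑ i, segment ℝ 0 (v i), p w ≤ p y)
    (hzmax : ∀ w ∈ {x} + ∑ i, segment ℝ 0 (v i), p w ≤ p z) : y - z ∈ U := by
  have hmem : ∀ y, y ∈ {x} + ∑ i, segment ℝ 0 (v i) ↔
      ∃ f : Fin n → E, (∀ i, f i ∈ segment ℝ 0 (v i)) ∧ y = x + ∑ i, f i := by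
    intro y
    rw [Set.singleton_add]
    constructor
    · rintro ⟨w, hw, rfl⟩
      obtain ⟨f, hf, rfl⟩ := (Set.mem_fintype_sum _ _).1 hw
      exact ⟨f, hf, rfl⟩
    · rintro ⟨f, hf, rfl⟩
      exact ⟨_, (Set.mem_fintype_sum _ _).2 ⟨f, hf, rfl⟩, rfl⟩
  -- Exchanging one summand at a time shows that each summand of a maximizer is maximal on its own
  -- segment.
  have hle : ∀ f g : Fin n → E, (∀ i, f i ∈ segment ℝ 0 (v i)) → (∀ i, g i ∈ segment ℝ 0 (v i)) →
      (∀ w ∈ {x} + ∑ i, segment ℝ 0 (v i), p w ≤ p (x + ∑ i, f i)) → ∀ i, p (g i) ≤ p (f i) := by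
    intro f g hf hg hmax i
    have h := hmax (x + ∑ j, Function.update f i (g i) j) ((hmem _).2 ⟨_, fun j => ?_, rfl⟩)
    · rw [Finset.sum_update_of_mem (Finset.mem_univ i),
        ← Finset.add_sum_erase Finset.univ f (Finset.mem_univ i), Finset.sdiff_singleton_eq_erase,
        map_add, map_add, map_add, map_add] at h
      linarith
    · rcases eq_or_ne j i with rfl | hj
      · simpa using hg j
      · simpa [hj] using hf j
  obtain ⟨f, hf, rfl⟩ := (hmem _).1 hy
  obtain ⟨g, hg, rfl⟩ := (hmem _).1 hz
  rw [add_sub_add_left_eq_sub, ← Finset.sum_sub_distrib]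
  refine Submodule.sum_mem _ fun i _ => ?_
  have heq : p (f i) = p (g i) :=
    le_antisymm (hle g f hg hf hzmax i) (hle f g hf hg hymax i)
  have hf' := hf i
  have hg' := hg i
  rw [segment_eq_image] at hf' hg'
  obtain ⟨a, -, ha⟩ := hf'
  obtain ⟨b, -, hb⟩ := hg'
  simp only [smul_zero, zero_add] at ha hb
  rw [← ha, ← hb] at heq ⊢
  rw [← sub_smul]
  by_cases h0 : p (v i) = 0
  · exact U.smul_mem _ (hU i h0)
  · rw [map_smul, map_smul, smul_eq_mul, smul_eq_mul] at heq
    rw [mul_right_cancel₀ h0 heq, sub_self, zero_smul]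
    exact U.zero_mem

/-- A functional that vanishes on a subspace and on no vector of a finite family outside of it. -/
theorem exists_dual_vanishing_iff {n : ℕ} (L : Submodule ℝ E) (v : Fin n → E) :
    ∃ p : Module.Dual ℝ E, L ≤ LinearMap.ker p ∧ ∀ i, p (v i) = 0 → v i ∈ L := by
  obtain ⟨f, hf⟩ := Module.exists_dual_forall_apply_ne_zero (K := ℝ)
    (fun i : {i // v i ∉ L} => L.mkQ (v i))
    (fun i h => i.2 ((Submodule.Quotient.mk_eq_zero L).1 h))
  refine ⟨f ∘ₗ L.mkQ, fun x hx => ?_, fun i hi => ?_⟩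
  · simp [(Submodule.Quotient.mk_eq_zero L).2 hx]
  · by_contra h
    exact hf ⟨i, h⟩ hi

/-- `p` may vanish on some `v i` outside `L`. Adding a small multiple of a `u` that kills `L` but no
such `v i` removes them, while `x` and `y` remain maximizers. Adding a common maximizer `b` from the
other summand moves `x` and `y` into one face of the zonotope. -/
theorem sub_mem_of_add_eq_zonotope {n : ℕ} {x₀ : E} {v : Fin n → E} {s s' : Finset E}
    (hs' : s'.Nonempty)
    (hsum : convexHull ℝ (s : Set E) + convexHull ℝ (s' : Set E) =
      {x₀} + ∑ i, segment ℝ 0 (v i))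
    {p : Module.Dual ℝ E} {L : Submodule ℝ E}
    (hL : ∀ x ∈ convexHull ℝ (s : Set E), ∀ y ∈ convexHull ℝ (s : Set E),
      (∀ z ∈ convexHull ℝ (s : Set E), p z ≤ p x) →
      (∀ z ∈ convexHull ℝ (s : Set E), p z ≤ p y) → x - y ∈ L)
    {U : Submodule ℝ E} (hU : ∀ i, v i ∈ L → v i ∈ U) {x y : E}
    (hx : x ∈ convexHull ℝ (s : Set E)) (hy : y ∈ convexHull ℝ (s : Set E))
    (hxm : ∀ z ∈ convexHull ℝ (s : Set E), p z ≤ p x)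
    (hym : ∀ z ∈ convexHull ℝ (s : Set E), p z ≤ p y) : x - y ∈ U := by
  obtain ⟨u, huL, hu⟩ := exists_dual_vanishing_iff L v
  have hev : ∀ᶠ t : ℝ in 𝓝[>] 0, (∀ z ∈ s, (p + t • u) z ≤ (p + t • u) x) ∧
      ∀ i, (p + t • u) (v i) = 0 → u (v i) = 0 := by
    have hcont : ∀ w, Continuous fun t : ℝ => (p + t • u) w := fun w => by
      simp only [LinearMap.add_apply, LinearMap.smul_apply]; fun_prop
    refine Eventually.and ?_ ?_
    · refine (eventually_all_finset s).2 fun z hz => ?_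
      have hz' := subset_convexHull ℝ (s : Set E) hz
      rcases (hxm z hz').lt_or_eq with h | h
      · have := (hcont z).continuousAt.eventually_lt (hcont x).continuousAt (x₀ := (0 : ℝ))
          (by simpa using h)
        exact (this.filter_mono nhdsWithin_le_nhds).mono fun t ht => ht.le
      · have : u (z - x) = 0 := huL (hL z hz' x hx (fun w hw => h ▸ hxm w hw) hxm)
        rw [map_sub, sub_eq_zero] at this
        exact Eventually.of_forall fun t => by simp [h, this]
    · refine eventually_all.2 fun i => ?_
      by_cases h : p (v i) = 0
      · filter_upwards [self_mem_nhdsWithin] with t ht h0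
        have ht' : t ≠ 0 := (show (0 : ℝ) < t from ht).ne'
        simpa [h, ht'] using h0
      · have := (hcont (v i)).continuousAt.eventually_ne (x := (0 : ℝ)) (y := 0) (by simpa using h)
        exact (this.filter_mono nhdsWithin_le_nhds).mono fun t ht h0 => absurd h0 ht
  obtain ⟨t, ht, hti⟩ := hev.exists
  obtain ⟨q, hq⟩ : ∃ q, q = p + t • u := ⟨_, rfl⟩
  rw [← hq] at ht hti
  obtain ⟨b, hb, hbm⟩ := s'.exists_max_image (fun x => q x) hs'
  have hqx : q x = q y := by
    have h1 : u (x - y) = 0 := huL (hL x hx y hy hxm hym)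
    rw [map_sub, sub_eq_zero] at h1
    simp [hq, h1, le_antisymm (hym x hx) (hxm y hy)]
  have hmax : ∀ w ∈ {x₀} + ∑ i, segment ℝ 0 (v i), q w ≤ q (x + b) := by
    rw [← hsum]
    rintro _ ⟨z, hz, c, hc, rfl⟩
    have h1 := dual_le_of_mem_convexHull q ht hz
    have h2 := dual_le_of_mem_convexHull q hbm hc
    simp only [map_add]
    linarith
  have hb' := subset_convexHull ℝ (s' : Set E) hb
  have key := sub_mem_of_mem_face (p := q) (U := U) (y := x + b) (z := y + b)
    (fun i hi => hU i (hu i (hti i hi))) (hsum ▸ Set.add_mem_add hx hb')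
    (hsum ▸ Set.add_mem_add hy hb') hmax
    (by simpa only [map_add, hqx] using hmax)
  rwa [add_sub_add_right_eq_sub] at key

end Summand

/-! ### Summands of zonotopes are `R`-convex -/

section Converse
variable {M : Type*} [AddCommGroup M]

theorem isRConvex_of_add_eq {R : Set M} {s s' : Finset (Ambient M)} (hs' : s'.Nonempty)
    (h : IsRZonotope R (convexHull ℝ (s : Set (Ambient M)) +
      convexHull ℝ (s' : Set (Ambient M)))) :
    IsRConvex R (convexHull ℝ (s : Set (Ambient M))) := by
  rintro F ⟨-, p, hF⟩
  obtain ⟨n, x₀, r, c, hr, hZ⟩ := h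
  refine ⟨{m ∈ R | intPoint m ∈ tangentSpace F}, fun m hm => hm.1, le_antisymm ?_ ?_⟩
  · refine Submodule.span_le.2 ?_
    rintro _ ⟨x, hx, y, hy, rfl⟩
    have hx' := hx
    have hy' := hy
    rw [hF] at hx' hy'
    refine sub_mem_of_add_eq_zonotope hs' hZ (p := p) (L := tangentSpace F) ?_ ?_
      hx'.1 hy'.1 hx'.2 hy'.2
    · intro a ha b hb ham hbm
      have haF : a ∈ F := by rw [hF]; exact ⟨ha, ham⟩
      have hbF : b ∈ F := by rw [hF]; exact ⟨hb, hbm⟩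
      exact Submodule.subset_span ⟨a, haF, b, hbF, rfl⟩
    · intro i hi
      by_cases h0 : c i = 0
      · simp [h0]
      · exact Submodule.smul_mem _ _ (Submodule.subset_span
          ⟨r i, ⟨(hr i).1, ((tangentSpace F).smul_mem_iff h0).1 hi⟩, rfl⟩)
  · refine Submodule.span_le.2 ?_
    rintro _ ⟨m, hm, rfl⟩
    exact hm.2

end Converse

end DiscreteConvexity

open DiscreteConvexity in
theorem proposition9 {M : Type*} [AddCommGroup M] [Module.Free ℤ M] [Module.Finite ℤ M]
    (R : Set M) (hR : IsUnimodular R) (P : Set (Ambient M)) (hP : IsPolytope P) :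
    (IsRConvex R P ↔
      ∃ P' : Set (Ambient M), IsPolytope P' ∧ IsRZonotope R (P + P')) ∧
    (IsRConvex R P →
      ∃ P' : Set (Ambient M), IsPolytope P' ∧
        ∃ S : Finset M, (S : Set M) = R ∧
          ∃ k : ℝ, 0 < k ∧ P + P' = k • symmZonotope S) := by
  obtain ⟨s, hs, rfl⟩ := hP
  obtain ⟨S, rfl⟩ := hR.finite.exists_finset_coe
  have hsummand : IsRConvex (S : Set M) (convexHull ℝ (s : Set (Ambient M))) →
      ∃ P' : Set (Ambient M), IsPolytope P' ∧ ∃ k : ℝ, 0 < k ∧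
        convexHull ℝ (s : Set (Ambient M)) + P' = k • symmZonotope S := by
    intro h
    obtain ⟨W, hW, k, hk, hsum⟩ :=
      exists_add_eq_smul_sum_segment S intPoint hs (h.exists_finset hs)
    exact ⟨_, ⟨W, hW, rfl⟩, k, hk, hsum⟩
  refine ⟨⟨fun h => ?_, ?_⟩, fun h => ?_⟩
  · obtain ⟨P', hP', k, -, hsum⟩ := hsummand h
    exact ⟨P', hP', hsum ▸ isRZonotope_smul_symmZonotope S k⟩
  · rintro ⟨_, ⟨s', hs', rfl⟩, h⟩
    exact isRConvex_of_add_eq hs' h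
  · obtain ⟨P', hP', k, hk, hsum⟩ := hsummand h
    exact ⟨P', hP', S, rfl, k, hk, hsum⟩
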